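/- Let $A$ be a finite alphabet. A word $w=a_1\cdots a_n\in A^*$ is viewed as a structure whose domain is its set of positions $\{1,\dots,n\}$ (empty if $w$ is the empty word), with unary predicates $P_a$ ($a\in A$), where $P_a(x)$ holds if and only if position $x$ carries the letter $a$. On positions consider the predicates $$\mathrm{bet}(x,y,z)\;:\iff\; x<y<z\ \text{ or }\ z<y<x,\qquad\qquad \mathrm{N}(x,y)\;:\iff\; x+1=y\ \text{ or }\ y+1=x .$$ For $\tau\in\{\mathrm{bet},\mathrm{N}\}$, let $\mathrm{MSO}(\tau)$ be monadic second-order logic with atomic formulas $P_a(x)$, $x=y$, $X(x)$ (position $x$ belongs to the set $X$) and $\tau$ applied to first-order variables, closed under Boolean combinations and under existential and universal quantification over positions and over sets of positions. A language $L\subseteq A^*$ is definable in $\mathrm{MSO}(\tau)$ if $L$ is the set of all words in $A^*$ that satisfy some sentence of $\mathrm{MSO}(\tau)$. Let $\mathrm{Rev}$ be the class of regular languages $L\subseteq A^*$ with $L^r=L$, where $L^r=\{a_k\cdots a_1 \mid a_1\cdots a_k\in L\}$. Then the class of languages over $A$ definable in $\mathrm{MSO}(\mathrm{bet})$, the class of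 languages over $A$ definable in $\mathrm{MSO}(\mathrm{N})$, and $\mathrm{Rev}$ are all equal. -/

import Mathlib

namespace WordLogic

/-- A predicate of a fixed arity on the positions of finite words. The positions of a word of
length `n` are the elements of `Fin n`. -/
structure PositionPred where
  arity : ℕ
  Holds : {n : ℕ} → (Fin arity → Fin n) → Prop

/-- `bet(x, y, z)` : `x < y < z` or `z < y < x`. -/
def bet : PositionPred where
  arity := 3
  Holds := fun {n} (p : Fin 3 → Fin n) => (p 0 < p 1 ∧ p 1 < p 2) ∨ (p 2 < p 1 ∧ p 1 < p 0)

/-- `N(x, y)` : `x + 1 = y` or `y + 1 = x`. -/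
def neighbour : PositionPred where
  arity := 2
  Holds := fun {n} (p : Fin 2 → Fin n) =>
    (p 0 : ℕ) + 1 = (p 1 : ℕ) ∨ (p 1 : ℕ) + 1 = (p 0 : ℕ)

/-- Formulas of `MSO(τ)` over the alphabet `A` whose free first-order variables are indexed by
`Fin k` and whose free set variables are indexed by `Fin m`. A quantifier binds the last variable
of its kind in its body. -/
inductive MSO (A : Type*) (τ : PositionPred) : ℕ → ℕ → Type _
  /-- `P_a(x)`: the position `x` carries the letter `a`. -/
  | letter {k m : ℕ} (a : A) (x : Fin k) : MSO A τ k m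
  /-- `x = y`. -/
  | eq {k m : ℕ} (x y : Fin k) : MSO A τ k m
  /-- `X(x)`: the position `x` belongs to the set `X`. -/
  | mem {k m : ℕ} (x : Fin k) (X : Fin m) : MSO A τ k m
  /-- `τ(x₁, …, xᵣ)`. -/
  | pred {k m : ℕ} (x : Fin τ.arity → Fin k) : MSO A τ k m
  | not {k m : ℕ} (φ : MSO A τ k m) : MSO A τ k m
  | and {k m : ℕ} (φ ψ : MSO A τ k m) : MSO A τ k m
  | or {k m : ℕ} (φ ψ : MSO A τ k m) : MSO A τ k m
  | existsPos {k m : ℕ} (φ : MSO A τ (k + 1) m) : MSO A τ k m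
  | forallPos {k m : ℕ} (φ : MSO A τ (k + 1) m) : MSO A τ k m
  | existsSet {k m : ℕ} (φ : MSO A τ k (m + 1)) : MSO A τ k m
  | forallSet {k m : ℕ} (φ : MSO A τ k (m + 1)) : MSO A τ k m

/-- Satisfaction in the word `w`, under an assignment `v` of positions of `w` to the first-order
variables and `V` of sets of positions to the set variables. -/
def MSO.Sat {A : Type*} {τ : PositionPred} (w : List A) :
    {k m : ℕ} → MSO A τ k m → (Fin k → Fin w.length) → (Fin m → Set (Fin w.length)) → Prop
  | _, _, .letter a x, v, _ => w.get (v x) = a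
  | _, _, .eq x y, v, _ => v x = v y
  | _, _, .mem x X, v, V => v x ∈ V X
  | _, _, .pred x, v, _ => τ.Holds (fun i => v (x i))
  | _, _, .not φ, v, V => ¬ φ.Sat w v V
  | _, _, .and φ ψ, v, V => φ.Sat w v V ∧ ψ.Sat w v V
  | _, _, .or φ ψ, v, V => φ.Sat w v V ∨ ψ.Sat w v V
  | _, _, .existsPos φ, v, V =>
      ∃ x : Fin w.length, φ.Sat w (Fin.snoc (α := fun _ => Fin w.length) v x) V
  | _, _, .forallPos φ, v, V =>
      ∀ x : Fin w.length, φ.Sat w (Fin.snoc (α := fun _ => Fin w.length) v x) V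
  | _, _, .existsSet φ, v, V =>
      ∃ X : Set (Fin w.length), φ.Sat w v (Fin.snoc (α := fun _ => Set (Fin w.length)) V X)
  | _, _, .forallSet φ, v, V =>
      ∀ X : Set (Fin w.length), φ.Sat w v (Fin.snoc (α := fun _ => Set (Fin w.length)) V X)

/-- The language of a sentence: the set of all finite words (including the empty word, whose set
of positions is empty) satisfying it. -/
def MSO.language {A : Type*} {τ : PositionPred} (φ : MSO A τ 0 0) : Language A :=
  {w : List A | φ.Sat w Fin.elim0 Fin.elim0}

/-- The class of languages over `A` definable by sentences of `MSO(τ)`. -/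
def msoDefinable (A : Type*) (τ : PositionPred) : Set (Language A) :=
  {L | ∃ φ : MSO A τ 0 0, φ.language = L}

/-- The class of reversible regular languages over `A`. -/
def reversibleRegular (A : Type*) : Set (Language A) :=
  {L | L.IsRegular ∧ L.reverse = L}

end WordLogic

/-! The three classes are compared by a cycle of inclusions: MSO(N) in MSO(bet), MSO(bet) in Rev,
Rev in MSO(N).

Neighbours are distinct positions with nothing between them, so N is definable from bet
(`neighbour_in_bet`).

For MSO(bet) in Rev, regularity is Büchi's argument: a word with an assignment is read as a word
over a larger alphabet, atomic formulas become simple automata, Boolean connectives become Boolean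
operations, and quantifiers become letter-to-letter projections (`isRegular_map`). Closure under
reversal holds because mirroring the positions preserves letters and bet (`sat_iff_of_equiv`).

For Rev in MSO(N), a sentence guesses an accepting run of a DFA, but N alone does not tell left from
right. Each position therefore also carries a counter in `ZMod 3`, required to differ at positions
at distance one or two. Such counters increase by one throughout or decrease by one throughout
(`counter_monotone`), so they orient the word up to reversal. The guess then succeeds on a nonempty
word iff the word or its mirror image is accepted (`exists_isOrientedRun_iff`), which for a
reversible language is membership. -/

namespace WordLogic

/-! ### Regular languages: basic automata and projections. -/

section Regular

variable {B C : Type*}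

/-- The words with a letter that satisfies `p`. -/
def containsLetter (p : B → Prop) : Language B := {u | ∃ c ∈ u, p c}

/-- The words in which no letter satisfying `p` precedes a letter satisfying `q`. -/
def neverBefore (p q : B → Prop) : Language B := {u | u.Pairwise fun a b => p a → ¬ q b}

theorem containsLetter_isRegular (p : B → Prop) : (containsLetter p).IsRegular := by
  let M : DFA B Prop := ⟨fun s c => s ∨ p c, False, {s | s}⟩
  refine ⟨Prop, inferInstance, M, ?_⟩
  have key : ∀ (u : List B) (s : Prop), M.evalFrom s u ↔ s ∨ ∃ c ∈ u, p c := by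
    intro u
    induction u with
    | nil => simp
    | cons c u ih =>
      intro s
      rw [DFA.evalFrom_cons, ih]
      simp [M, or_assoc]
  ext u
  exact (key u False).trans (by simp [containsLetter]; rfl)

theorem neverBefore_isRegular (p q : B → Prop) : (neverBefore p q).IsRegular := by
  -- The state records whether a `p`-letter has been read, and whether no violation has occurred so
  -- far.
  let M : DFA B (Prop × Prop) :=
    ⟨fun s c => (s.1 ∨ p c, s.2 ∧ ¬ (s.1 ∧ q c)), (False, True), {s | s.2}⟩
  refine ⟨Prop × Prop, inferInstance, M, ?_⟩
  have key : ∀ (u : List B) (s : Prop × Prop), (M.evalFrom s u).2 ↔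
      s.2 ∧ (s.1 → ∀ c ∈ u, ¬ q c) ∧ u.Pairwise fun a b => p a → ¬ q b := by
    intro u
    induction u with
    | nil => simp
    | cons c u ih =>
      intro s
      rw [DFA.evalFrom_cons, ih]
      simp only [M, List.mem_cons, List.pairwise_cons, forall_eq_or_imp]
      grind
  ext u
  exact (key u (False, True)).trans (by simp [neverBefore]; rfl)

/-- The image of a regular language under a letter-to-letter map is regular. -/
theorem isRegular_map (π : B → C) {L : Language B} (hL : L.IsRegular) :
    Language.IsRegular ({u | ∃ u' ∈ L, u'.map π = u} : Language C) := by
  obtain ⟨σ, _, M, rfl⟩ := hL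
  -- The automaton guesses a preimage of each letter and simulates `M` on it.
  let N : NFA C σ := ⟨fun s c => {t | ∃ b, π b = c ∧ M.step s b = t}, {M.start}, M.accept⟩
  classical
  refine ⟨Set σ, inferInstance, N.toDFA, ?_⟩
  rw [NFA.toDFA_correct]
  have key : ∀ (u : List C) (S : Set σ) (t : σ), t ∈ N.evalFrom S u ↔
      ∃ s ∈ S, ∃ u' : List B, u'.map π = u ∧ M.evalFrom s u' = t := by
    intro u
    induction u with
    | nil => simp
    | cons c u ih =>
      intro S t
      rw [NFA.evalFrom_cons, ih]
      constructor
      · rintro ⟨s, hs, u', rfl, rfl⟩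
        obtain ⟨r, hr, b, rfl, rfl⟩ := NFA.mem_stepSet.1 hs
        exact ⟨r, hr, b :: u', rfl, rfl⟩
      · rintro ⟨s, hs, u', hu', rfl⟩
        obtain ⟨b, u'', rfl, rfl, rfl⟩ := List.map_eq_cons_iff.1 hu'
        exact ⟨M.step s b, NFA.mem_stepSet.2 ⟨s, hs, b, rfl, rfl⟩, u'', rfl, rfl⟩
  ext u
  rw [NFA.mem_accepts]
  constructor
  · rintro ⟨t, ht, h⟩
    obtain ⟨s, rfl, u', rfl, rfl⟩ := (key _ _ _).1 h
    exact ⟨u', ht, rfl⟩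
  · rintro ⟨u', hu', rfl⟩
    exact ⟨_, hu', (key _ _ _).2 ⟨_, rfl, u', rfl, rfl⟩⟩

theorem exists_ofFn_of_map_eq {π : B → C} {u : List B} {n : ℕ} {f : Fin n → C}
    (h : u.map π = List.ofFn f) : ∃ g : Fin n → B, u = List.ofFn g ∧ ∀ i, π (g i) = f i := by
  have hn : u.length = n := by simpa using congrArg List.length h
  subst hn
  refine ⟨u.get, (List.ofFn_get u).symm, fun i => ?_⟩
  have := List.getElem_of_eq h (i := i) (by simp)
  simpa using this

end Regular

/-! ### Büchi's argument: from MSO(bet) to automata. -/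

section Recognizable

variable {A : Type*}

/-- A relation between words and assignments of their positions and sets of positions to `k`
first-order and `m` set variables. -/
abbrev Relation (A : Type*) (k m : ℕ) :=
  (w : List A) → (Fin k → Fin w.length) → (Fin m → Set (Fin w.length)) → Prop

/-- A word with an assignment, as a word whose letters record which variables hold there. -/
def encode {k m : ℕ} (w : List A) (v : Fin k → Fin w.length) (V : Fin m → Set (Fin w.length)) :
    List (A × Set (Fin k) × Set (Fin m)) :=
  List.ofFn fun i => (w.get i, {x | v x = i}, {X | i ∈ V X})

/-- A relation is recognizable if a regular language decides it on encoded assignments. -/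
def Recognizable {k m : ℕ} (R : Relation A k m) : Prop :=
  ∃ L : Language (A × Set (Fin k) × Set (Fin m)), L.IsRegular ∧
    ∀ w v V, encode w v V ∈ L ↔ R w v V

namespace Recognizable

variable {k m : ℕ} {R S : Relation A k m}

theorem congr (hR : Recognizable R) (h : ∀ w v V, R w v V ↔ S w v V) : Recognizable S := by
  obtain ⟨L, hL, hLR⟩ := hR
  exact ⟨L, hL, fun w v V => (hLR w v V).trans (h w v V)⟩

theorem not (hR : Recognizable R) : Recognizable fun w v V => ¬ R w v V := by
  obtain ⟨L, hL, hLR⟩ := hR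
  exact ⟨Lᶜ, hL.compl, fun w v V => not_congr (hLR w v V)⟩

theorem and (hR : Recognizable R) (hS : Recognizable S) :
    Recognizable fun w v V => R w v V ∧ S w v V := by
  obtain ⟨L, hL, hLR⟩ := hR
  obtain ⟨K, hK, hKS⟩ := hS
  exact ⟨L ⊓ K, hL.inf hK, fun w v V => and_congr (hLR w v V) (hKS w v V)⟩

theorem or (hR : Recognizable R) (hS : Recognizable S) :
    Recognizable fun w v V => R w v V ∨ S w v V :=
  (hR.not.and hS.not).not.congr fun _ _ _ => by tauto

theorem existsLetter (p : A → Set (Fin k) → Set (Fin m) → Prop) :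
    Recognizable fun w v V => ∃ i, p (w.get i) {x | v x = i} {X | i ∈ V X} := by
  refine ⟨_, containsLetter_isRegular fun c => p c.1 c.2.1 c.2.2, fun w v V => ?_⟩
  change (∃ c ∈ encode w v V, _) ↔ _
  simp [encode]

/-- In an encoded word each first-order variable marks exactly one position, so the order holds
precisely when `neverBefore` fails for the two marks. -/
theorem lt (x y : Fin k) : Recognizable fun (_ : List A) v (_ : Fin m → Set _) => v x < v y := by
  refine ⟨_, (neverBefore_isRegular (fun c => x ∈ c.2.1) (fun c => y ∈ c.2.1)).compl,
    fun w v V => ?_⟩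
  change ¬ (encode w v V).Pairwise _ ↔ _
  simp [encode, List.pairwise_ofFn]

theorem existsPos {R : (w : List A) → (Fin k → Fin w.length) → (Fin m → Set (Fin w.length)) →
      Fin w.length → Prop}
    (hR : Recognizable fun w (v : Fin (k + 1) → _) (V : Fin m → _) =>
      R w (Fin.init v) V (v (Fin.last k))) :
    Recognizable fun w v V => ∃ x, R w v V x := by
  obtain ⟨L, hL, hLR⟩ := hR
  let p : A × Set (Fin (k + 1)) × Set (Fin m) → Prop := fun c => Fin.last k ∈ c.2.1
  -- The erased track must encode a single position: `containsLetter` gives at least one mark,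
  -- `neverBefore p p` at most one.
  refine ⟨_, isRegular_map (fun c => (c.1, Fin.castSucc ⁻¹' c.2.1, c.2.2))
    (hL.inf ((containsLetter_isRegular p).inf (neverBefore_isRegular p p))), fun w v V => ?_⟩
  have hx : ∀ x : Fin w.length, encode w (Fin.snoc (α := fun _ => Fin w.length) v x) V ∈ L ↔
      R w v V x := fun x => by simp [hLR]
  constructor
  · rintro ⟨u, ⟨huL, huE, huP⟩, hu⟩
    obtain ⟨g, rfl, hg⟩ := exists_ofFn_of_map_eq hu
    obtain ⟨c, hc, hpc⟩ := huE
    obtain ⟨x, rfl⟩ := (List.mem_ofFn' _ _).1 hc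
    have huP' := List.pairwise_ofFn.1 huP
    refine ⟨x, (hx x).1 ?_⟩
    refine (congrArg (· ∈ L) (congrArg List.ofFn (funext fun i => ?_))).mpr huL
    have hgi := hg i
    simp only [Prod.mk.injEq] at hgi
    refine Prod.ext hgi.1.symm (Prod.ext (Set.ext fun y => ?_) hgi.2.2.symm)
    induction y using Fin.lastCases with
    | last =>
      simp only [Set.mem_ofPred_eq, Fin.snoc_last]
      constructor
      · rintro rfl
        exact hpc
      · intro hi
        rcases lt_trichotomy x i with h | h | h
        · exact absurd hi (huP' h hpc)
        · exact h
        · exact absurd hpc (huP' h hi)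
    | cast y => simpa using (Set.ext_iff.1 hgi.2.1 y).symm
  · rintro ⟨x, h⟩
    refine ⟨_, ⟨(hx x).2 h, ⟨_, (List.mem_ofFn' _ _).2 ⟨x, rfl⟩, by simp [p]⟩,
      List.pairwise_ofFn.2 ?_⟩, ?_⟩
    · intro i j hij hi hj
      simp only [p, Set.mem_ofPred_eq, Fin.snoc_last] at hi hj
      exact hij.ne (hi.symm.trans hj)
    · simp only [encode, List.map_ofFn]
      refine congrArg List.ofFn (funext fun i => ?_)
      simp [Set.preimage]

/-- Every subset of positions is a legitimate value of the erased track, so plain projection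
suffices, without a uniqueness constraint. -/
theorem existsSet {R : (w : List A) → (Fin k → Fin w.length) → (Fin m → Set (Fin w.length)) →
      Set (Fin w.length) → Prop}
    (hR : Recognizable fun w (v : Fin k → _) (V : Fin (m + 1) → _) =>
      R w v (Fin.init V) (V (Fin.last m))) :
    Recognizable fun w v V => ∃ X, R w v V X := by
  obtain ⟨L, hL, hLR⟩ := hR
  refine ⟨_, isRegular_map (fun c => (c.1, c.2.1, Fin.castSucc ⁻¹' c.2.2)) hL, fun w v V => ?_⟩
  have hX : ∀ X : Set (Fin w.length),
      encode w v (Fin.snoc (α := fun _ => Set (Fin w.length)) V X) ∈ L ↔ R w v V X :=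
    fun X => by simp [hLR]
  constructor
  · rintro ⟨u, huL, hu⟩
    obtain ⟨g, rfl, hg⟩ := exists_ofFn_of_map_eq hu
    refine ⟨{i | Fin.last m ∈ (g i).2.2}, (hX _).1 ?_⟩
    refine (congrArg (· ∈ L) (congrArg List.ofFn (funext fun i => ?_))).mpr huL
    have hgi := hg i
    simp only [Prod.mk.injEq] at hgi
    refine Prod.ext hgi.1.symm (Prod.ext hgi.2.1.symm (Set.ext fun Y => ?_))
    induction Y using Fin.lastCases with
    | last => simp
    | cast Y => simpa using (Set.ext_iff.1 hgi.2.2 Y).symm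
  · rintro ⟨X, h⟩
    refine ⟨_, (hX X).2 h, ?_⟩
    simp only [encode, List.map_ofFn]
    refine congrArg List.ofFn (funext fun i => ?_)
    simp [Set.preimage]

theorem bet (x : Fin 3 → Fin k) :
    Recognizable fun (_ : List A) v (_ : Fin m → Set _) => bet.Holds fun i => v (x i) :=
  ((lt (x 0) (x 1)).and (lt (x 1) (x 2))).or ((lt (x 2) (x 1)).and (lt (x 1) (x 0)))

theorem sat : ∀ {k m : ℕ} (φ : MSO A WordLogic.bet k m), Recognizable fun w v V => φ.Sat w v V
  | _, _, .letter a x => (existsLetter fun b S _ => b = a ∧ x ∈ S).congr fun w v V => by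
      simp [MSO.Sat]
  | _, _, .eq x y => (existsLetter fun _ S _ => x ∈ S ∧ y ∈ S).congr fun w v V => by
      simp [MSO.Sat, eq_comm]
  | _, _, .mem x X => (existsLetter fun _ S T => x ∈ S ∧ X ∈ T).congr fun w v V => by
      simp [MSO.Sat]
  | _, _, .pred x => bet x
  | _, _, .not φ => (sat φ).not
  | _, _, .and φ ψ => (sat φ).and (sat ψ)
  | _, _, .or φ ψ => (sat φ).or (sat ψ)
  | _, _, .existsPos φ => existsPos ((sat φ).congr fun w v V => by simp)
  | _, _, .forallPos φ =>
      (existsPos (R := fun w v V x => ¬ φ.Sat w (Fin.snoc (α := fun _ => Fin w.length) v x) V)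
        ((sat φ).not.congr fun w v V => by simp)).not.congr fun w v V => by simp [MSO.Sat]
  | _, _, .existsSet φ => existsSet ((sat φ).congr fun w v V => by simp)
  | _, _, .forallSet φ =>
      (existsSet (R := fun w v V X => ¬ φ.Sat w v (Fin.snoc (α := fun _ => Set (Fin w.length)) V X))
        ((sat φ).not.congr fun w v V => by simp)).not.congr fun w v V => by simp [MSO.Sat]

end Recognizable

/-- Without free variables the encoding adds no information, so the projection to `A` is injective
and carries the deciding language to the one defined. -/
theorem isRegular_of_recognizable {R : Relation A 0 0} (hR : Recognizable R) :
    Language.IsRegular ({w | R w Fin.elim0 Fin.elim0} : Language A) := by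
  obtain ⟨L, hL, hLR⟩ := hR
  refine (congrArg Language.IsRegular ?_).mpr (isRegular_map Prod.fst hL)
  have henc : ∀ w : List A, (encode w Fin.elim0 Fin.elim0 :
      List (A × Set (Fin 0) × Set (Fin 0))).map Prod.fst = w := fun w => by
    simp only [encode, List.map_ofFn]
    exact List.ofFn_get w
  have hinj : Function.Injective (Prod.fst : A × Set (Fin 0) × Set (Fin 0) → A) :=
    fun a b h => Prod.ext h (Subsingleton.elim _ _)
  ext w
  constructor
  · intro h
    exact ⟨_, (hLR _ _ _).2 h, henc w⟩
  · rintro ⟨u, hu, rfl⟩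
    refine (hLR _ _ _).1 ?_
    rwa [List.map_injective_iff.2 hinj (henc (u.map Prod.fst))]

end Recognizable

/-! ### Invariance under bijections of positions; reversal. -/

section Invariance

variable {A : Type*} {τ : PositionPred}

/-- Satisfaction is invariant under bijections of positions that preserve the letters and `τ`. -/
theorem sat_iff_of_equiv {w w' : List A} (e : Fin w.length ≃ Fin w'.length)
    (hw : ∀ i, w'.get (e i) = w.get i)
    (hτ : ∀ p : Fin τ.arity → Fin w.length, τ.Holds (fun i => e (p i)) ↔ τ.Holds p) :
    ∀ {k m : ℕ} (φ : MSO A τ k m) (v : Fin k → Fin w.length) (V : Fin m → Set (Fin w.length)),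
      φ.Sat w' (fun x => e (v x)) (fun X => e.symm ⁻¹' V X) ↔ φ.Sat w v V
  | _, _, .letter a x, v, V => by simp only [MSO.Sat, hw]
  | _, _, .eq x y, v, V => by simp [MSO.Sat]
  | _, _, .mem x X, v, V => by simp [MSO.Sat]
  | _, _, .pred x, v, V => hτ _
  | _, _, .not φ, v, V => not_congr (sat_iff_of_equiv e hw hτ φ v V)
  | _, _, .and φ ψ, v, V =>
      and_congr (sat_iff_of_equiv e hw hτ φ v V) (sat_iff_of_equiv e hw hτ ψ v V)
  | _, _, .or φ ψ, v, V =>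
      or_congr (sat_iff_of_equiv e hw hτ φ v V) (sat_iff_of_equiv e hw hτ ψ v V)
  | _, _, .existsPos φ, v, V => by
      simp only [MSO.Sat, e.symm.exists_congr_left, Equiv.symm_symm]
      refine exists_congr fun x => ?_
      rw [← sat_iff_of_equiv e hw hτ φ, ← Function.comp_def e (Fin.snoc _ _), Fin.comp_snoc]; rfl
  | _, _, .forallPos φ, v, V => by
      simp only [MSO.Sat, e.symm.forall_congr_left, Equiv.symm_symm]
      refine forall_congr' fun x => ?_
      rw [← sat_iff_of_equiv e hw hτ φ, ← Function.comp_def e (Fin.snoc _ _), Fin.comp_snoc]; rfl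
  | _, _, .existsSet φ, v, V => by
      simp only [MSO.Sat, (Equiv.Set.congr e).symm.exists_congr_left, Equiv.symm_symm]
      refine exists_congr fun X => ?_
      rw [← sat_iff_of_equiv e hw hτ φ,
        ← Function.comp_def (Set.preimage e.symm) (Fin.snoc _ _), Fin.comp_snoc]
      simp [Function.comp_def, Equiv.image_eq_preimage_symm]
  | _, _, .forallSet φ, v, V => by
      simp only [MSO.Sat, (Equiv.Set.congr e).symm.forall_congr_left, Equiv.symm_symm]
      refine forall_congr' fun X => ?_
      rw [← sat_iff_of_equiv e hw hτ φ,
        ← Function.comp_def (Set.preimage e.symm) (Fin.snoc _ _), Fin.comp_snoc]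
      simp [Function.comp_def, Equiv.image_eq_preimage_symm]

/-- The reversal of positions, from a word to its mirror image. -/
def reversePos (w : List A) : Fin w.length ≃ Fin w.reverse.length :=
  Fin.revPerm.trans (finCongr List.length_reverse.symm)

theorem reversePos_val (w : List A) (i : Fin w.length) :
    (reversePos w i : ℕ) = w.length - (i + 1) := by
  simp [reversePos]

theorem get_reversePos (w : List A) (i : Fin w.length) :
    w.reverse.get (reversePos w i) = w.get i := by
  have hi := i.2
  simp only [List.get_eq_getElem, List.getElem_reverse, reversePos_val]
  congr 1
  omega

theorem bet_reversePos (w : List A) (p : Fin 3 → Fin w.length) :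
    bet.Holds (fun i => reversePos w (p i)) ↔ bet.Holds p := by
  simp only [bet, Fin.lt_def, reversePos_val]
  omega

theorem neighbour_reversePos (w : List A) (p : Fin 2 → Fin w.length) :
    neighbour.Holds (fun i => reversePos w (p i)) ↔ neighbour.Holds p := by
  simp only [neighbour, reversePos_val]
  omega

theorem msoDefinable_bet_subset : msoDefinable A bet ⊆ reversibleRegular A := by
  rintro _ ⟨φ, rfl⟩
  refine ⟨isRegular_of_recognizable (Recognizable.sat φ), ?_⟩
  ext w
  change φ.Sat w.reverse _ _ ↔ φ.Sat w _ _
  rw [← sat_iff_of_equiv (reversePos w) (get_reversePos w) (bet_reversePos w) φ]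
  exact iff_of_eq (congrArg₂ _ (Subsingleton.elim _ _) (Subsingleton.elim _ _))

end Invariance

/-! ### Closure properties of definable relations; N in terms of bet. -/

section Definable

variable {A : Type*} {τ : PositionPred} {k m : ℕ}

/-- A relation is definable if it is the satisfaction relation of a formula of `MSO(τ)`. -/
def Definable (τ : PositionPred) (R : Relation A k m) : Prop :=
  ∃ φ : MSO A τ k m, ∀ w v V, φ.Sat w v V ↔ R w v V

namespace Definable

variable {R S : Relation A k m}

theorem congr (hR : Definable τ R) (h : ∀ w v V, R w v V ↔ S w v V) : Definable τ S := by
  obtain ⟨φ, hφ⟩ := hR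
  exact ⟨φ, fun w v V => (hφ w v V).trans (h w v V)⟩

theorem letter (a : A) (x : Fin k) :
    Definable τ fun (w : List A) v (_ : Fin m → Set _) => w.get (v x) = a :=
  ⟨.letter a x, fun _ _ _ => Iff.rfl⟩

theorem eq (x y : Fin k) :
    Definable τ fun (_ : List A) v (_ : Fin m → Set _) => v x = v y :=
  ⟨.eq x y, fun _ _ _ => Iff.rfl⟩

theorem mem (x : Fin k) (X : Fin m) :
    Definable τ fun (_ : List A) v V => v x ∈ V X :=
  ⟨.mem x X, fun _ _ _ => Iff.rfl⟩

theorem pred (x : Fin τ.arity → Fin k) :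
    Definable τ fun (_ : List A) v (_ : Fin m → Set _) => τ.Holds fun i => v (x i) :=
  ⟨.pred x, fun _ _ _ => Iff.rfl⟩

theorem not (hR : Definable τ R) : Definable τ fun w v V => ¬ R w v V := by
  obtain ⟨φ, hφ⟩ := hR
  exact ⟨.not φ, fun w v V => not_congr (hφ w v V)⟩

theorem and (hR : Definable τ R) (hS : Definable τ S) :
    Definable τ fun w v V => R w v V ∧ S w v V := by
  obtain ⟨φ, hφ⟩ := hR
  obtain ⟨ψ, hψ⟩ := hS
  exact ⟨.and φ ψ, fun w v V => and_congr (hφ w v V) (hψ w v V)⟩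

theorem or (hR : Definable τ R) (hS : Definable τ S) :
    Definable τ fun w v V => R w v V ∨ S w v V := by
  obtain ⟨φ, hφ⟩ := hR
  obtain ⟨ψ, hψ⟩ := hS
  exact ⟨.or φ ψ, fun w v V => or_congr (hφ w v V) (hψ w v V)⟩

theorem imp (hR : Definable τ R) (hS : Definable τ S) :
    Definable τ fun w v V => R w v V → S w v V :=
  (hR.not.or hS).congr fun _ _ _ => imp_iff_not_or.symm

theorem existsPos {R : (w : List A) → (Fin k → Fin w.length) → (Fin m → Set (Fin w.length)) →
      Fin w.length → Prop}
    (hR : Definable τ fun w (v : Fin (k + 1) → _) (V : Fin m → _) =>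
      R w (Fin.init v) V (v (Fin.last k))) :
    Definable τ fun w v V => ∃ x, R w v V x := by
  obtain ⟨φ, hφ⟩ := hR
  exact ⟨.existsPos φ, fun w v V => by simp [MSO.Sat, hφ]⟩

theorem forallPos {R : (w : List A) → (Fin k → Fin w.length) → (Fin m → Set (Fin w.length)) →
      Fin w.length → Prop}
    (hR : Definable τ fun w (v : Fin (k + 1) → _) (V : Fin m → _) =>
      R w (Fin.init v) V (v (Fin.last k))) :
    Definable τ fun w v V => ∀ x, R w v V x := by
  obtain ⟨φ, hφ⟩ := hR
  exact ⟨.forallPos φ, fun w v V => by simp [MSO.Sat, hφ]⟩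

theorem existsSet {R : (w : List A) → (Fin k → Fin w.length) → (Fin m → Set (Fin w.length)) →
      Set (Fin w.length) → Prop}
    (hR : Definable τ fun w (v : Fin k → _) (V : Fin (m + 1) → _) =>
      R w v (Fin.init V) (V (Fin.last m))) :
    Definable τ fun w v V => ∃ X, R w v V X := by
  obtain ⟨φ, hφ⟩ := hR
  exact ⟨.existsSet φ, fun w v V => by simp [MSO.Sat, hφ]⟩

theorem forallSet {R : (w : List A) → (Fin k → Fin w.length) → (Fin m → Set (Fin w.length)) →
      Set (Fin w.length) → Prop}
    (hR : Definable τ fun w (v : Fin k → _) (V : Fin (m + 1) → _) =>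
      R w v (Fin.init V) (V (Fin.last m))) :
    Definable τ fun w v V => ∀ X, R w v V X := by
  obtain ⟨φ, hφ⟩ := hR
  exact ⟨.forallSet φ, fun w v V => by simp [MSO.Sat, hφ]⟩

theorem false : Definable τ fun (w : List A) (_ : Fin k → Fin w.length)
    (_ : Fin m → Set (Fin w.length)) => False :=
  (existsPos (R := fun _ _ _ x => ¬ x = x) (eq (Fin.last k) (Fin.last k)).not).congr
    fun _ _ _ => by simp

/-- This turns conditions on states and counters, which do not involve the word, into formulas. -/
theorem const (p : Prop) : Definable τ fun (w : List A) (_ : Fin k → Fin w.length)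
    (_ : Fin m → Set (Fin w.length)) => p := by
  by_cases hp : p
  · exact false.not.congr fun _ _ _ => by simp [hp]
  · exact false.congr fun _ _ _ => by simp [hp]

theorem exists_finite {ι : Type*} [Finite ι] {R : ι → Relation A k m}
    (hR : ∀ i, Definable τ (R i)) : Definable τ fun w v V => ∃ i, R i w v V := by
  cases nonempty_fintype ι
  classical
  suffices h : ∀ s : Finset ι, Definable τ fun w v V => ∃ i ∈ s, R i w v V from
    (h Finset.univ).congr fun _ _ _ => by simp
  intro s
  induction s using Finset.induction_on with
  | empty => exact false.congr fun _ _ _ => by simp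
  | insert i s _ ih => exact ((hR i).or ih).congr fun _ _ _ => by simp

theorem forall_finite {ι : Type*} [Finite ι] {R : ι → Relation A k m}
    (hR : ∀ i, Definable τ (R i)) : Definable τ fun w v V => ∀ i, R i w v V :=
  (exists_finite fun i => (hR i).not).not.congr fun _ _ _ => by simp

theorem existsSets : ∀ {m : ℕ} {R : Relation A 0 m}, Definable τ R →
    Definable (m := 0) τ fun w v _ => ∃ V, R w v V
  | 0, R, hR => hR.congr fun w v V =>
      ⟨fun h => ⟨V, h⟩, fun ⟨_, h⟩ => by convert h⟩
  | m + 1, R, hR =>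
      (existsSets (m := m) (existsSet
        (R := fun w v V X => R w v (Fin.snoc (α := fun _ => Set (Fin w.length)) V X))
        (hR.congr fun w v V => by simp))).congr fun w v _ => by
      constructor
      · rintro ⟨V, X, h⟩
        exact ⟨_, h⟩
      · rintro ⟨V, h⟩
        exact ⟨Fin.init V, V (Fin.last m), by simpa using h⟩

/-- If the atomic formulas of `τ` are definable in `MSO(τ')`, all formulas of `MSO(τ)` are. -/
theorem sat_of_pred {τ' : PositionPred}
    (h : ∀ {k m : ℕ} (x : Fin τ.arity → Fin k), Definable τ'
      fun (w : List A) v (_ : Fin m → Set (Fin w.length)) => τ.Holds fun i => v (x i)) :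
    ∀ {k m : ℕ} (φ : MSO A τ k m), Definable τ' fun w v V => φ.Sat w v V
  | _, _, .letter a x => letter a x
  | _, _, .eq x y => eq x y
  | _, _, .mem x X => mem x X
  | _, _, .pred x => h x
  | _, _, .not φ => (sat_of_pred h φ).not
  | _, _, .and φ ψ => (sat_of_pred h φ).and (sat_of_pred h ψ)
  | _, _, .or φ ψ => (sat_of_pred h φ).or (sat_of_pred h ψ)
  | _, _, .existsPos φ => existsPos ((sat_of_pred h φ).congr fun w v V => by simp)
  | _, _, .forallPos φ => forallPos ((sat_of_pred h φ).congr fun w v V => by simp)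
  | _, _, .existsSet φ => existsSet ((sat_of_pred h φ).congr fun w v V => by simp)
  | _, _, .forallSet φ => forallSet ((sat_of_pred h φ).congr fun w v V => by simp)

theorem neighbour (x y : Fin k) : Definable neighbour fun (w : List A) v
    (_ : Fin m → Set (Fin w.length)) => (v x : ℕ) + 1 = v y ∨ (v y : ℕ) + 1 = v x :=
  pred (τ := WordLogic.neighbour) ![x, y]

/-- Two positions are neighbours iff they are distinct and no position lies between them. -/
theorem neighbour_in_bet (x : Fin 2 → Fin k) : Definable bet fun (w : List A) v
    (_ : Fin m → Set (Fin w.length)) => WordLogic.neighbour.Holds fun i => v (x i) := by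
  have hbet : Definable bet fun (w : List A) v (_ : Fin m → Set (Fin w.length)) =>
      ∃ z, (v (x 0) < z ∧ z < v (x 1)) ∨ (v (x 1) < z ∧ z < v (x 0)) :=
    existsPos (pred (τ := bet) ![(x 0).castSucc, Fin.last k, (x 1).castSucc])
  refine ((eq (x 0) (x 1)).not.and hbet.not).congr fun w v _ => ?_
  simp only [WordLogic.neighbour]
  generalize v (x 0) = a, v (x 1) = b
  constructor
  · rintro ⟨hne, hz⟩
    by_contra hN
    refine hz ?_
    -- The successor of the smaller position lies strictly between, since the two are not
    -- neighbours.
    rcases lt_or_gt_of_ne hne with h | h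
    · exact ⟨⟨a + 1, by omega⟩, Or.inl ⟨by simp [Fin.lt_def], by simp [Fin.lt_def]; omega⟩⟩
    · exact ⟨⟨b + 1, by omega⟩, Or.inr ⟨by simp [Fin.lt_def], by simp [Fin.lt_def]; omega⟩⟩
  · rintro hN
    refine ⟨fun h => by subst h; omega, fun ⟨z, hz⟩ => ?_⟩
    simp only [Fin.lt_def] at hz
    omega

end Definable

theorem msoDefinable_neighbour_subset_bet :
    msoDefinable A neighbour ⊆ msoDefinable A bet := by
  rintro _ ⟨φ, rfl⟩
  obtain ⟨ψ, hψ⟩ := Definable.sat_of_pred Definable.neighbour_in_bet φ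
  exact ⟨ψ, Set.ext fun w => hψ w _ _⟩

end Definable

/-! ### Oriented runs: from reversible regular languages to MSO(N). -/

section Run

variable {A σ : Type*}

/-- `y` follows `x` in the orientation that the second components of the labels determine. -/
def Follows {n : ℕ} (lab : Fin n → σ × ZMod 3 → Prop) (x y : Fin n) : Prop :=
  ((x : ℕ) + 1 = y ∨ (y : ℕ) + 1 = x) ∧ ∃ b c, lab x b ∧ lab y c ∧ c.2 = b.2 + 1

/-- The labels are a run of the automaton `M` on `w`, or on its mirror image, together with
counters modulo 3 that determine an orientation of the positions. -/
structure IsOrientedRun (M : DFA A σ) (w : List A) (lab : Fin w.length → σ × ZMod 3 → Prop) :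
    Prop where
  label : ∀ x, ∃ b, ∀ c, lab x c ↔ c = b
  ne : ∀ x y : Fin w.length, ((x : ℕ) + 1 = y ∨ (y : ℕ) + 1 = x) → ∀ b c, lab x b → lab y c → b.2 ≠ c.2
  ne_ne : ∀ x y z : Fin w.length, ((x : ℕ) + 1 = y ∨ (y : ℕ) + 1 = x) →
    ((y : ℕ) + 1 = z ∨ (z : ℕ) + 1 = y) → ¬ x = z → ∀ b c, lab x b → lab z c → b.2 ≠ c.2
  step : ∀ x y, Follows lab x y → ∀ b c a, lab x b → lab y c → w.get y = a → c.1 = M.step b.1 a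
  start : ∀ x, (∀ y, ¬ Follows lab y x) →
    ∀ b a, lab x b → w.get x = a → b.1 = M.step M.start a
  accept : ∀ x, (∀ y, ¬ Follows lab x y) → ∀ b, lab x b → b.1 ∈ M.accept

/-- There are finitely many labels and letters, so quantifiers over them are finite Boolean
combinations; what remains of each field is built from atomic formulas and constant conditions on
labels. -/
theorem definable_isOrientedRun [Finite A] [Finite σ] (M : DFA A σ) {m : ℕ}
    (e : σ × ZMod 3 → Fin m) : Definable (k := 0) neighbour fun w _ V =>
      IsOrientedRun M w fun x b => x ∈ V (e b) := by
  have hF : ∀ {k : ℕ} (x y : Fin k), Definable neighbour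
      fun (w : List A) v (V : Fin m → Set _) => Follows (fun x b => x ∈ V (e b)) (v x) (v y) := by
    intro k x y
    refine (Definable.neighbour x y).and ?_
    exact .exists_finite fun b => .exists_finite fun c =>
      .and (.mem x _) (.and (.mem y _) (.const _))
  refine Definable.congr (.and ?_ (.and ?_ (.and ?_ (.and ?_ (.and ?_ ?_)))))
    fun w v V => (⟨fun ⟨h₁, h₂, h₃, h₄, h₅, h₆⟩ => ⟨h₁, h₂, h₃, h₄, h₅, h₆⟩,
      fun ⟨h₁, h₂, h₃, h₄, h₅, h₆⟩ => ⟨h₁, h₂, h₃, h₄, h₅, h₆⟩⟩ :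
        _ ↔ IsOrientedRun M w fun x b => x ∈ V (e b))
  · refine .forallPos <| .exists_finite fun b => .forall_finite fun c => ?_
    exact (((Definable.mem 0 _).imp (.const _)).and ((Definable.const _).imp (.mem 0 _))).congr
      fun _ _ _ => iff_def.symm
  · refine .forallPos ?_
    refine .forallPos ?_
    refine .imp (.neighbour 0 1) <| .forall_finite fun b =>
      .forall_finite fun c => ?_
    exact .imp (.mem 0 _) (.imp (.mem 1 _) (.const _))
  · refine .forallPos ?_
    refine .forallPos ?_
    refine .forallPos ?_
    refine .imp (.neighbour 0 1) <|
      .imp (.neighbour 1 2) <| .imp (Definable.eq 0 2).not <| .forall_finite fun b =>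
      .forall_finite fun c => ?_
    exact .imp (.mem 0 _) (.imp (.mem 2 _) (.const _))
  · refine .forallPos ?_
    refine .forallPos ?_
    refine .imp (hF 0 1) <| .forall_finite fun b =>
      .forall_finite fun c => .forall_finite fun a => ?_
    exact .imp (.mem 0 _) (.imp (.mem 1 _) (.imp (.letter a 1) (.const _)))
  · refine .forallPos <| .imp (.forallPos (hF 1 0).not) <| .forall_finite fun b =>
      .forall_finite fun a => ?_
    exact .imp (.mem 0 _) (.imp (.letter a 0) (.const _))
  · refine .forallPos <| .imp (.forallPos (hF 0 1).not) <| .forall_finite fun b => ?_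
    exact .imp (.mem 0 _) (.const _)

/-- Counters modulo 3 that distinguish positions at distance at most two run monotonically. -/
theorem counter_monotone {n : ℕ} (c : Fin n → ZMod 3)
    (h₁ : ∀ i (h : i + 1 < n), c ⟨i, by omega⟩ ≠ c ⟨i + 1, h⟩)
    (h₂ : ∀ i (h : i + 2 < n), c ⟨i, by omega⟩ ≠ c ⟨i + 2, h⟩) :
    (∀ i (h : i + 1 < n), c ⟨i + 1, h⟩ = c ⟨i, by omega⟩ + 1) ∨
      ∀ i (h : i + 1 < n), c ⟨i, by omega⟩ = c ⟨i + 1, h⟩ + 1 := by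
  have key : ∀ a b : ZMod 3, a ≠ b → b = a + 1 ∨ a = b + 1 := by decide
  -- Of the three residues only one differs from two given distinct ones, so each step repeats the
  -- direction of the previous one.
  have up : ∀ a b d : ZMod 3, b = a + 1 → b ≠ d → a ≠ d → d = b + 1 := by decide
  have down : ∀ a b d : ZMod 3, a = b + 1 → b ≠ d → a ≠ d → b = d + 1 := by decide
  by_cases hn : 0 + 1 < n
  · refine (key _ _ (h₁ 0 hn)).imp (fun h0 i => ?_) fun h0 i => ?_
    · induction i with
      | zero => exact fun _ => h0
      | succ i ih => exact fun h => up _ _ _ (ih (by omega)) (h₁ _ h) (h₂ i h)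
    · induction i with
      | zero => exact fun _ => h0
      | succ i ih => exact fun h => down _ _ _ (ih (by omega)) (h₁ _ h) (h₂ i h)
  · exact Or.inl fun i h => by omega

/-- An accepting run, with increasing counters. -/
theorem isOrientedRun_of_mem (M : DFA A σ) {w : List A} (hw : w ∈ M.accepts) :
    IsOrientedRun M w fun x b => b = (M.eval (w.take (x + 1)), ((x : ℕ) : ZMod 3)) := by
  have hF : ∀ x y : Fin w.length, Follows (fun (x : Fin w.length) b =>
      b = (M.eval (w.take (x + 1)), ((x : ℕ) : ZMod 3))) x y ↔ (x : ℕ) + 1 = y := by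
    intro x y
    simp only [Follows]
    constructor
    · rintro ⟨h | h, _, _, rfl, rfl, hc⟩
      · exact h
      -- A backward step lowers the counter by one, which is not raising it by one, as `2 ≠ 0` in
      -- `ZMod 3`.
      · rw [← h] at hc
        push_cast at hc
        exact absurd hc ((by decide : ∀ a : ZMod 3, ¬ a = a + 1 + 1) _)
    · exact fun h => ⟨Or.inl h, _, _, rfl, rfl, by simp [← h]⟩
  have hdist : ∀ (i : ℕ), (i : ZMod 3) ≠ ((i + 1 : ℕ) : ZMod 3) ∧
      (i : ZMod 3) ≠ ((i + 2 : ℕ) : ZMod 3) := by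
    intro i
    push_cast
    generalize (i : ZMod 3) = a
    revert a
    decide
  have hstep : ∀ x : Fin w.length, M.eval (w.take (x + 1)) =
      M.step (M.eval (w.take x)) (w.get x) := by
    intro x
    rw [List.take_add_one, List.getElem?_eq_getElem x.2]
    exact M.eval_append_singleton _ _
  constructor
  · exact fun x => ⟨_, fun c => Iff.rfl⟩
  · rintro x y (h | h) _ _ rfl rfl
    · simpa only [← h] using (hdist x).1
    · simpa only [← h] using (hdist y).1.symm
  · rintro x y z hxy hyz hxz _ _ rfl rfl
    have : (x : ℕ) + 2 = z ∨ (z : ℕ) + 2 = x := by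
      have := fun h => hxz (Fin.ext h)
      omega
    rcases this with h | h
    · simpa only [← h] using (hdist x).2
    · simpa only [← h] using (hdist z).2.symm
  · rintro x y h _ _ _ rfl rfl rfl
    rw [hF] at h
    simp only [hstep y, h]
  · rintro x h _ _ rfl rfl
    simp only [hF] at h
    have hx : (x : ℕ) = 0 := by
      by_contra hx
      exact h ⟨x - 1, by omega⟩ (by simp; omega)
    rw [hstep x, hx, List.take_zero, DFA.eval_nil]
  · rintro x h _ rfl
    simp only [hF] at h
    have hx : w.length ≤ x + 1 := by
      by_contra hx
      exact h ⟨x + 1, by omega⟩ rfl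
    rw [List.take_of_length_le hx]
    exact hw

theorem IsOrientedRun.exists_label {M : DFA A σ} {w : List A}
    {lab : Fin w.length → σ × ZMod 3 → Prop} (h : IsOrientedRun M w lab) :
    ∃ f : Fin w.length → σ × ZMod 3, (lab = fun x b => b = f x) ∧
      ((∀ i (hi : i + 1 < w.length), (f ⟨i + 1, hi⟩).2 = (f ⟨i, by omega⟩).2 + 1) ∨
        ∀ i (hi : i + 1 < w.length), (f ⟨i, by omega⟩).2 = (f ⟨i + 1, hi⟩).2 + 1) := by
  choose f hf using h.label
  refine ⟨f, funext₂ fun x b => propext (hf x b), counter_monotone (fun x => (f x).2) ?_ ?_⟩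
  · exact fun i hi => h.ne _ _ (Or.inl rfl) _ _ ((hf _ _).2 rfl) ((hf _ _).2 rfl)
  · exact fun i hi => h.ne_ne ⟨i, by omega⟩ ⟨i + 1, by omega⟩ ⟨i + 2, hi⟩ (Or.inl rfl) (Or.inl rfl)
      (by rw [Fin.mk.injEq]; omega) _ _ ((hf _ _).2 rfl) ((hf _ _).2 rfl)

/-- With increasing counters `Follows` is the successor relation, so the start and step conditions
force the state at each position to be the value of `M` on the prefix ending there. Nonemptiness
provides the last position, where acceptance is read off. -/
theorem mem_accepts_of_isOrientedRun {M : DFA A σ} {w : List A} (hw : w ≠ [])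
    {f : Fin w.length → σ × ZMod 3} (h : IsOrientedRun M w fun x b => b = f x)
    (hf : ∀ i (hi : i + 1 < w.length), (f ⟨i + 1, hi⟩).2 = (f ⟨i, by omega⟩).2 + 1) :
    w ∈ M.accepts := by
  have hF : ∀ x y, Follows (fun x b => b = f x) x y ↔ (x : ℕ) + 1 = y := by
    rintro ⟨x, hx⟩ ⟨y, hy⟩
    simp only [Follows]
    constructor
    · rintro ⟨rfl | rfl, _, _, rfl, rfl, hc⟩
      · rfl
      · rw [hf _ hx] at hc
        exact absurd hc ((by decide : ∀ a : ZMod 3, ¬ a = a + 1 + 1) _)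
    · rintro rfl
      exact ⟨Or.inl rfl, _, _, rfl, rfl, hf _ hy⟩
  have hrun : ∀ i (hi : i < w.length), (f ⟨i, hi⟩).1 = M.eval (w.take (i + 1)) := by
    intro i
    induction i with
    | zero =>
      intro hi
      rw [h.start ⟨0, hi⟩ (fun y hy => by simpa using (hF _ _).1 hy) _ _ rfl rfl,
        List.take_add_one, List.getElem?_eq_getElem hi]
      simp [DFA.eval, DFA.evalFrom]
    | succ i ih =>
      intro hi
      rw [h.step ⟨i, by omega⟩ ⟨i + 1, hi⟩ ((hF _ _).2 rfl) _ _ _ rfl rfl rfl, ih,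
        List.take_add_one (i := i + 1), List.getElem?_eq_getElem hi]
      exact (M.eval_append_singleton _ _).symm
  have hpos := List.length_pos_of_ne_nil hw
  have hacc := h.accept ⟨w.length - 1, by omega⟩
    (fun y hy => by have := (hF _ _).1 hy; have := y.2; simp at *; omega) _ rfl
  rw [hrun, List.take_of_length_le (by omega)] at hacc
  exact hacc

/-- A nonempty word has an oriented run iff the automaton accepts it or its mirror image. -/
theorem exists_isOrientedRun_iff [Finite A] [Finite σ] (M : DFA A σ) {m : ℕ}
    (e : σ × ZMod 3 ≃ Fin m) {w : List A} (hw : w ≠ []) :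
    (∃ V : Fin m → Set (Fin w.length), IsOrientedRun M w fun x b => x ∈ V (e b)) ↔
      w ∈ M.accepts ∨ w.reverse ∈ M.accepts := by
  obtain ⟨φ, hφ⟩ := definable_isOrientedRun M e
  -- Being an oriented run is an MSO(N) property, so its invariance under reversal follows from that
  -- of satisfaction.
  have hrev : ∀ (u : List A) (V : Fin m → Set (Fin u.length)),
      (IsOrientedRun M u.reverse fun x b => x ∈ (reversePos u).symm ⁻¹' V (e b)) ↔
        IsOrientedRun M u fun x b => x ∈ V (e b) := by
    intro u V
    refine Iff.trans ?_ ((sat_iff_of_equiv (reversePos u) (get_reversePos u)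
      (neighbour_reversePos u) φ Fin.elim0 V).trans (hφ _ _ _))
    exact (hφ u.reverse _ fun X => (reversePos u).symm ⁻¹' V X).symm
  have hmem : ∀ u ∈ M.accepts,
      ∃ V : Fin m → Set (Fin u.length), IsOrientedRun M u fun x b => x ∈ V (e b) :=
    fun u hu => ⟨fun X => {x | e.symm X = (M.eval (u.take (x + 1)), ((x : ℕ) : ZMod 3))},
      by simpa using isOrientedRun_of_mem M hu⟩
  constructor
  · rintro ⟨V, hV⟩
    obtain ⟨f, hlab, hf | hf⟩ := hV.exists_label
    · exact Or.inl (mem_accepts_of_isOrientedRun hw (hlab ▸ hV) hf)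
    -- Decreasing counters become increasing when the labels are carried to the mirror image.
    · refine Or.inr (mem_accepts_of_isOrientedRun (f := fun x => f ((reversePos w).symm x))
        (by simpa using hw) ?_ fun i hi => ?_)
      · have := (hrev w V).2 hV
        convert this using 3 with x b
        exact (iff_of_eq (congrFun (congrFun hlab ((reversePos w).symm x)) b)).symm
      · have hl : w.reverse.length = w.length := List.length_reverse
        have hs : ∀ j (hj : j < w.reverse.length),
            (reversePos w).symm ⟨j, hj⟩ = ⟨w.length - (j + 1), by omega⟩ := by
          intro j hj
          rw [Equiv.symm_apply_eq]
          ext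
          rw [reversePos_val]
          simp only
          omega
        simp only [hs]
        have := hf (w.length - (i + 1 + 1)) (by omega)
        simp only [show w.length - (i + 1 + 1) + 1 = w.length - (i + 1) by omega] at this
        exact this
  · rintro (h | h)
    · exact hmem w h
    · have hrun : ∃ V : Fin m → Set (Fin w.reverse.reverse.length),
          IsOrientedRun M w.reverse.reverse fun x b => x ∈ V (e b) := by
        obtain ⟨V, hV⟩ := hmem _ h
        exact ⟨fun X => (reversePos _).symm ⁻¹' V X, (hrev _ V).2 hV⟩
      rwa [List.reverse_reverse] at hrun

theorem reversibleRegular_subset [Finite A] :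
    reversibleRegular A ⊆ msoDefinable A neighbour := by
  rintro L ⟨⟨σ, _, M, rfl⟩, hrev⟩
  let e := Fintype.equivFin (σ × ZMod 3)
  have hne : Definable (k := 0) (m := 0) neighbour fun (w : List A) _ _ =>
      ∃ x : Fin w.length, True := .existsPos (.const True)
  -- The empty word has only vacuous runs, so its membership is inserted as a constant, guarded by
  -- the absence of positions.
  obtain ⟨φ, hφ⟩ := (hne.and (definable_isOrientedRun M e).existsSets).or
    (hne.not.and (.const ([] ∈ M.accepts)))
  refine ⟨φ, Set.ext fun w => (hφ w _ _).trans ?_⟩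
  rcases eq_or_ne w [] with rfl | hw
  · simp
    rfl
  · have hx : ∃ x : Fin w.length, True := ⟨⟨0, List.length_pos_of_ne_nil hw⟩, trivial⟩
    have hw' : w.reverse ∈ M.accepts ↔ w ∈ M.accepts := by
      conv_rhs => rw [← hrev]
      rfl
    simp only [hx, exists_isOrientedRun_iff M e hw, hw', or_self, true_and, not_true_eq_false,
      false_and, or_false]
    rfl

end Run

end WordLogic

theorem mainTheorem4 (A : Type*) [Finite A] :
    WordLogic.msoDefinable A WordLogic.bet = WordLogic.msoDefinable A WordLogic.neighbour ∧
      WordLogic.msoDefinable A WordLogic.neighbour = WordLogic.reversibleRegular A := by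
  have h₁ := WordLogic.msoDefinable_neighbour_subset_bet (A := A)
  have h₂ := WordLogic.msoDefinable_bet_subset (A := A)
  have h₃ := WordLogic.reversibleRegular_subset (A := A)
  exact ⟨(h₂.trans h₃).antisymm h₁, (h₁.trans h₂).antisymm h₃⟩
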